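/- A Petri net over an alphabet $\Sigma$ is a tuple $N=(P,T,F,\lambda,M_0,M_f)$ with disjoint finite sets $P$ of places and $T$ of transitions, a flow function $F\colon (P\cup T)\times(P\cup T)\to\mathbb N$, a labelling $\lambda\colon T\to\Sigma$ and markings $M_0,M_f\in\mathbb N^P$. A transition $t$ is enabled in a marking $M$ if $M(p)\ge F(p,t)$ for all $p\in P$, and firing it then leads to $M'$ with $M'(p)=M(p)-F(p,t)+F(t,p)$. The (coverability) language $L(N)$ is the set of words $\lambda(t_1)\cdots\lambda(t_m)$ such that firing $t_1,\dots,t_m$ successively from $M_0$ is possible and leads to a marking $M$ with $M\ge M_f$ componentwise. With $\|\cdot\|$ denoting the maximum of the values, the size of $N$ is $$|N|=|P|\,|T|\,\bigl(1+\lceil\log_2(1+\|F\|)\rceil\bigr)+|M_0|+|M_f|,\qquad |M|=|P|\,\bigl(1+\lceil\log_2(1+\|M\|)\rceil\bigr).$$ For $x\in\{0,1\}$ and $k\ge 1$ let $\mathcal L_{x@k}$ be the set of words in $\{0,1\}^*$ of length at least $k$ whose $k$-th last letter is $x$. A language $R$ separates two languages if it contains one of them and is disjoint from the other. **Theorem.**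 There is a polynomial $q$ such that for every $n\in\mathbb N$ there are Petri nets $N_0(n)$ and $N_1(n)$ over the alphabet $\{0,1,b,c\}$ with $|N_0(n)|\le q(n)$ and $|N_1(n)|\le q(n)$ such that: 1. there are non-empty languages $\mathcal L',\mathcal L''\subseteq b^*$ with $L(N_x(n))=\mathcal L'.c.\mathcal L_{x@2^{2^n}}.c.\mathcal L''$ for both $x\in\{0,1\}$; 2. $L(N_0(n))\cap L(N_1(n))=\emptyset$; 3. every (complete) deterministic finite automaton whose language separates $L(N_0(n))$ and $L(N_1(n))$ has at least $2^{2^{2^n}}$ states. -/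

import Mathlib

/-- A labelled Petri net `(P, T, F, λ, M₀, M_f)` over the alphabet `α`. Places and transitions are
separate finite types, so the disjoint union `P ∪ T` is the sum type `Place ⊕ Trans`. Every
transition carries a letter (there are no silent transitions). -/
structure PetriNet (α : Type) where
  Place : Type
  Trans : Type
  [placeFintype : Fintype Place]
  [transFintype : Fintype Trans]
  flow : Place ⊕ Trans → Place ⊕ Trans → ℕ
  label : Trans → α
  init : Place → ℕ
  final : Place → ℕ

namespace PetriNet

attribute [instance] PetriNet.placeFintype PetriNet.transFintype

variable {α : Type}

/-- `N.Fires M t M'`: transition `t` is enabled in the marking `M`, and firing it leads to `M'`.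
The subtraction does not truncate, since `t` is enabled. -/
def Fires (N : PetriNet α) (M : N.Place → ℕ) (t : N.Trans) (M' : N.Place → ℕ) : Prop :=
  (∀ p, N.flow (Sum.inl p) (Sum.inr t) ≤ M p) ∧
    ∀ p, M' p = M p - N.flow (Sum.inl p) (Sum.inr t) + N.flow (Sum.inr t) (Sum.inl p)

/-- `N.Run M w M'`: some sequence of firings labelled by the word `w` leads from `M` to `M'`. -/
inductive Run (N : PetriNet α) : (N.Place → ℕ) → List α → (N.Place → ℕ) → Prop
  | nil (M : N.Place → ℕ) : Run N M [] M
  | cons {M M' M'' : N.Place → ℕ} {w : List α} (t : N.Trans) :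
      N.Fires M t M' → Run N M' w M'' → Run N M (N.label t :: w) M''

/-- The coverability language: the words that label a run from the initial marking to some marking
that is componentwise at least the final marking. -/
def language (N : PetriNet α) : Language α :=
  {w | ∃ M, N.Run N.init w M ∧ ∀ p, N.final p ≤ M p}

/-- The infinity norm of a marking (`0` if there are no places). -/
def markingNorm (N : PetriNet α) (M : N.Place → ℕ) : ℕ :=
  Finset.univ.sup M

/-- The infinity norm of the flow function, the largest value that it takes. -/
def flowNorm (N : PetriNet α) : ℕ :=
  Finset.univ.sup fun x : (N.Place ⊕ N.Trans) × (N.Place ⊕ N.Trans) => N.flow x.1 x.2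

/-- The size of a marking in binary encoding, `|P| (1 + ⌈log₂ (1 + ‖M‖)⌉)`. -/
def markingSize (N : PetriNet α) (M : N.Place → ℕ) : ℕ :=
  Fintype.card N.Place * (1 + Nat.clog 2 (1 + N.markingNorm M))

/-- The size of a net in binary encoding, `|P| |T| (1 + ⌈log₂ (1 + ‖F‖)⌉) + |M₀| + |M_f|`. -/
def size (N : PetriNet α) : ℕ :=
  Fintype.card N.Place * Fintype.card N.Trans * (1 + Nat.clog 2 (1 + N.flowNorm))
    + N.markingSize N.init + N.markingSize N.final

end PetriNet

/-- `R` separates `L` and `K`: it contains one of the two languages and is disjoint from the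
other. -/
def IsSeparator {α : Type} (R L K : Language α) : Prop :=
  (L ≤ R ∧ ∀ w ∈ R, w ∉ K) ∨ (K ≤ R ∧ ∀ w ∈ R, w ∉ L)

/-- The four-letter alphabet `{0, 1, b, c}`; the letters `0` and `1` are `bit false` and
`bit true`. -/
inductive Letter : Type
  | bit (x : Bool)
  | b
  | c

/-- The binary words of length at least `k` whose `k`-th last letter is `x`, for `k ≥ 1`: the letter
`x` is followed by exactly `k - 1` further letters. -/
def kthLastLang (x : Bool) (k : ℕ) : Language Bool :=
  {w | ∃ u v : List Bool, w = u ++ x :: v ∧ v.length + 1 = k}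

/-! Suppose that adding `k` to a counter and subtracting `k` from it are available as primitive
calls. Then a constant-size automaton, `bitNet`, finds the `k`-th last letter: it loads `k` units,
guesses the position, moves one unit to a second counter for each letter from there on, and finally
subtracts `k` from the second counter. The two counters sum to `k` once loaded, so the subtraction
succeeds only if the first one is empty. Thus coverability suffices for an exact count.

Calls of amount `2 ^ 2 ^ n` are implemented by Lipton's squaring. `lower` replaces a call of amount
`k * k` by two nested loops of `k` rounds each, whose counters are loaded and tested for zero by
calls of amount `k`: every loop counter has a complement, the two sum to `k`, and subtracting `k`
from the complement is a zero test. All calls share one loop, with a token as return address, so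
each level adds a bounded number of components, and after `n` levels the amount is `2`. Paths
through the loop are forced, hence all calls of a level have the same label length, and the padding
is a single word in `b*`, the same for both nets. `acc_lower_iff` and `acc_lower_iterate_iff` carry
this part.

For the state bound, prefixes that carry different words of length `k` must reach different states:
a position where they differ becomes the `k`-th last one after suitable padding
(`two_pow_le_card_of_isSeparator`). -/

/-! ### Counter automata with calls. -/

/-- `Shift pre post v v'`: the counter valuation `v` is at least `pre`, and `v' = v - pre + post`. -/
def Shift {C : Type} (pre post v v' : C → ℕ) : Prop :=
  ∀ c, pre c ≤ v c ∧ v' c + pre c = v c + post c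

theorem shift_zero_zero {C : Type} {v w : C → ℕ} : Shift 0 0 v w ↔ w = v := by
  simp [Shift, funext_iff]

theorem shift_zero_left {C : Type} {p w : C → ℕ} : Shift 0 p 0 w ↔ w = p := by
  simp [Shift, funext_iff]

theorem shift_self {C : Type} {v w p : C → ℕ} : Shift p p v w ↔ p ≤ v ∧ w = v := by
  simp [Shift, funext_iff, Pi.le_def, forall_and]

theorem shift_zero_right {C : Type} {v w p : C → ℕ} : Shift p 0 v w ↔ p ≤ v ∧ w + p = v := by
  simp [Shift, funext_iff, Pi.le_def, forall_and]

theorem single_one_le_single_one {C : Type} [DecidableEq C] {s t : C} :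
    (Pi.single t 1 : C → ℕ) ≤ Pi.single s 1 ↔ t = s := by
  constructor
  · intro h
    have := h t
    by_contra hne
    simp [hne] at this
  · rintro rfl
    exact le_rfl

/-- A counter automaton. Its ordinary transitions consume `pre` and produce `post`; in addition it
has calls, each of which adds an amount to a single counter (if `callUp`) or subtracts that amount
from it. The amount is a parameter of the semantics. -/
structure CounterNet (α : Type) where
  State : Type
  Ctr : Type
  Trans : Type
  Call : Type
  [stateFintype : Fintype State]
  [ctrFintype : Fintype Ctr]
  [transFintype : Fintype Trans]
  [callFintype : Fintype Call]
  [stateDecEq : DecidableEq State]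
  [ctrDecEq : DecidableEq Ctr]
  [callDecEq : DecidableEq Call]
  src : Trans → State
  dst : Trans → State
  label : Trans → α
  pre : Trans → Ctr → ℕ
  post : Trans → Ctr → ℕ
  callSrc : Call → State
  callDst : Call → State
  callUp : Call → Bool
  callCtr : Call → Ctr
  /-- The label of the calls. -/
  idle : α
  start : State
  final : State

namespace CounterNet

attribute [instance] stateFintype ctrFintype transFintype callFintype stateDecEq ctrDecEq callDecEq

variable {α : Type}

/-- What a call consumes, for the amount `k`. -/
def callPre (V : CounterNet α) (k : ℕ) (t : V.Call) : V.Ctr → ℕ :=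
  if V.callUp t then 0 else Pi.single (V.callCtr t) k

/-- What a call produces, for the amount `k`. -/
def callPost (V : CounterNet α) (k : ℕ) (t : V.Call) : V.Ctr → ℕ :=
  if V.callUp t then Pi.single (V.callCtr t) k else 0

/-- `V.Acc k d q v w`: the word `w` labels a path from state `q` with counters `v` to the final
state, where calls have amount `k` and are labelled by `d` copies of the letter `idle`. -/
inductive Acc (V : CounterNet α) (k d : ℕ) : V.State → (V.Ctr → ℕ) → List α → Prop
  | done (v : V.Ctr → ℕ) : Acc V k d V.final v []
  | step (t : V.Trans) {v v' : V.Ctr → ℕ} {w : List α} :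
      Shift (V.pre t) (V.post t) v v' → Acc V k d (V.dst t) v' w →
        Acc V k d (V.src t) v (V.label t :: w)
  | call (t : V.Call) {v v' : V.Ctr → ℕ} {w : List α} :
      Shift (V.callPre k t) (V.callPost k t) v v' → Acc V k d (V.callDst t) v' w →
        Acc V k d (V.callSrc t) v (List.replicate d V.idle ++ w)

theorem shift_call_zero (V : CounterNet α) {t : V.Call} {v w : V.Ctr → ℕ} :
    Shift (V.callPre 0 t) (V.callPost 0 t) v w ↔ w = v := by
  simp [callPre, callPost, shift_zero_zero]

/-- A call only adds or only subtracts, on one counter, so amounts compose additively; this fails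
for shifts that do both. It lets the loop perform a large call in unit steps. -/
theorem shift_call_add (V : CounterNet α) {t : V.Call} {m n : ℕ} {v w : V.Ctr → ℕ} :
    Shift (V.callPre (m + n) t) (V.callPost (m + n) t) v w ↔
      ∃ u, Shift (V.callPre m t) (V.callPost m t) v u ∧
        Shift (V.callPre n t) (V.callPost n t) u w := by
  constructor
  · intro hs
    -- The subtraction does not truncate, since `v` covers even the amount `m + n`.
    refine ⟨fun c => v c + V.callPost m t c - V.callPre m t c, fun c => ?_, fun c => ?_⟩ <;>
    · have := hs c
      cases h : V.callUp t <;> by_cases hc : c = V.callCtr t <;>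
        simp_all [callPre, callPost] <;> omega
  · rintro ⟨u, hu, hw⟩ c
    have h₁ := hu c
    have h₂ := hw c
    cases h : V.callUp t <;> by_cases hc : c = V.callCtr t <;>
      simp_all [callPre, callPost] <;> omega

end CounterNet

/-! ### The squaring construction. -/

/-- The control states of a doubly nested loop. -/
inductive LoopState
  | entry | outer | fill | inner | exit
  deriving DecidableEq

instance : Fintype LoopState :=
  ⟨{.entry, .outer, .fill, .inner, .exit}, fun s => by cases s <;> decide⟩

/-- The counters of a doubly nested loop: `x` and `y` count the outer and the inner rounds to go,
`x'` and `y'` those done. -/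
inductive LoopCtr
  | x | x' | y | y'
  deriving DecidableEq

instance : Fintype LoopCtr :=
  ⟨{.x, .x', .y, .y'}, fun i => by cases i <;> decide⟩

/-- A counter valuation given by its parts. -/
def loopVal {C T : Type} (v : C → ℕ) (a a' j j' : ℕ) (r : T → ℕ) : C ⊕ (LoopCtr ⊕ T) → ℕ
  | .inl c => v c
  | .inr (.inl .x) => a
  | .inr (.inl .x') => a'
  | .inr (.inl .y) => j
  | .inr (.inl .y') => j'
  | .inr (.inr t) => r t

theorem shift_loopVal {C T : Type} {pv qv v : C → ℕ} {p₁ p₂ p₃ p₄ q₁ q₂ q₃ q₄ a a' j j' : ℕ}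
    {pr qr r : T → ℕ} {w : C ⊕ (LoopCtr ⊕ T) → ℕ} :
    Shift (loopVal pv p₁ p₂ p₃ p₄ pr) (loopVal qv q₁ q₂ q₃ q₄ qr) (loopVal v a a' j j' r) w ↔
      ∃ v₁ b b' i i' r₁, w = loopVal v₁ b b' i i' r₁ ∧ Shift pv qv v v₁ ∧
        (p₁ ≤ a ∧ b + p₁ = a + q₁) ∧ (p₂ ≤ a' ∧ b' + p₂ = a' + q₂) ∧
        (p₃ ≤ j ∧ i + p₃ = j + q₃) ∧ (p₄ ≤ j' ∧ i' + p₄ = j' + q₄) ∧ Shift pr qr r r₁ := by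
  constructor
  · intro h
    refine ⟨fun c => w (.inl c), w (.inr (.inl .x)), w (.inr (.inl .x')), w (.inr (.inl .y)),
      w (.inr (.inl .y')), fun t => w (.inr (.inr t)), ?_, fun c => h (.inl c), h (.inr (.inl .x)),
      h (.inr (.inl .x')), h (.inr (.inl .y)), h (.inr (.inl .y')), fun t => h (.inr (.inr t))⟩
    funext c
    rcases c with c | (_ | _ | _ | _) | t <;> rfl
  · rintro ⟨v₁, b, b', i, i', r₁, rfl, hv, h₁, h₂, h₃, h₄, hr⟩
    rintro (c | (_ | _ | _ | _) | t)
    exacts [hv c, h₁, h₂, h₃, h₄, hr t]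

namespace CounterNet

variable {α : Type}

/-- Replaces calls of amount `k * k` by calls of amount `k`: a call becomes a transition into a
shared doubly nested loop with `k` times `k` rounds, in each of which the call is made with amount
`1`. A token on an extra counter tells the loop which call it performs. -/
def lower (V : CounterNet α) : CounterNet α where
  State := V.State ⊕ LoopState
  Ctr := V.Ctr ⊕ (LoopCtr ⊕ V.Call)
  Trans := V.Trans ⊕ (V.Call ⊕ (V.Call ⊕ (V.Call ⊕ Unit)))
  Call := LoopCtr
  src
    | .inl t => .inl (V.src t)
    | .inr (.inl t) => .inl (V.callSrc t)
    | .inr (.inr (.inl _)) => .inr .inner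
    | .inr (.inr (.inr (.inl _))) => .inr .exit
    | .inr (.inr (.inr (.inr _))) => .inr .outer
  dst
    | .inl t => .inl (V.dst t)
    | .inr (.inl _) => .inr .entry
    | .inr (.inr (.inl _)) => .inr .inner
    | .inr (.inr (.inr (.inl t))) => .inl (V.callDst t)
    | .inr (.inr (.inr (.inr _))) => .inr .fill
  label
    | .inl t => V.label t
    | .inr _ => V.idle
  pre
    | .inl t => loopVal (V.pre t) 0 0 0 0 0
    | .inr (.inl _) => loopVal 0 0 0 0 0 0
    | .inr (.inr (.inl t)) => loopVal (V.callPre 1 t) 0 0 1 0 (Pi.single t 1)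
    | .inr (.inr (.inr (.inl t))) => loopVal 0 0 0 0 0 (Pi.single t 1)
    | .inr (.inr (.inr (.inr _))) => loopVal 0 1 0 0 0 0
  post
    | .inl t => loopVal (V.post t) 0 0 0 0 0
    | .inr (.inl t) => loopVal 0 0 0 0 0 (Pi.single t 1)
    | .inr (.inr (.inl t)) => loopVal (V.callPost 1 t) 0 0 0 1 (Pi.single t 1)
    | .inr (.inr (.inr (.inl _))) => loopVal 0 0 0 0 0 0
    | .inr (.inr (.inr (.inr _))) => loopVal 0 0 1 0 0 0
  callSrc
    | .x => .inr .entry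
    | .x' => .inr .outer
    | .y => .inr .fill
    | .y' => .inr .inner
  callDst
    | .x => .inr .outer
    | .x' => .inr .exit
    | .y => .inr .inner
    | .y' => .inr .outer
  callUp
    | .x | .y => true
    | .x' | .y' => false
  callCtr i := .inr (.inl i)
  idle := V.idle
  start := .inl V.start
  final := .inl V.final

/-- The calls of `V.lower` change one loop counter. -/
theorem shift_lower_call (V : CounterNet α) (k : ℕ) (i : LoopCtr)
    {u w : V.Ctr ⊕ (LoopCtr ⊕ V.Call) → ℕ} :
    Shift (V.lower.callPre k i) (V.lower.callPost k i) u w ↔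
      Shift (loopVal 0 0 (if i = .x' then k else 0) 0 (if i = .y' then k else 0) 0)
        (loopVal 0 (if i = .x then k else 0) 0 (if i = .y then k else 0) 0 0) u w := by
  have h₁ : V.lower.callPre k i =
      (loopVal 0 0 (if i = .x' then k else 0) 0 (if i = .y' then k else 0) 0 :
        V.Ctr ⊕ (LoopCtr ⊕ V.Call) → ℕ) := by
    funext c
    cases i <;> rcases c with c | (_ | _ | _ | _) | t <;> rfl
  have h₂ : V.lower.callPost k i =
      (loopVal 0 (if i = .x then k else 0) 0 (if i = .y then k else 0) 0 0 :
        V.Ctr ⊕ (LoopCtr ⊕ V.Call) → ℕ) := by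
    funext c
    cases i <;> rcases c with c | (_ | _ | _ | _) | t <;> rfl
  rw [h₁, h₂]
  rfl

/-! ### Paths of the lowered automaton come from paths of the original. -/

/-- The number of labels from the head of the outer loop with `a` rounds to go up to the return. -/
def outerLen (k d a : ℕ) : ℕ :=
  a * (1 + d + k + d) + d + 1

/-- After `l` idle letters, the word `w` goes on with a path that starts where the call `t` of
amount `m` leads. -/
def Resume (V : CounterNet α) (K D : ℕ) (t : V.Call) (v : V.Ctr → ℕ) (l m : ℕ) (w : List α) :
    Prop :=
  ∃ v' w', w = List.replicate l V.idle ++ w' ∧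
    Shift (V.callPre m t) (V.callPost m t) v v' ∧ V.Acc K D (V.callDst t) v' w'

theorem Resume.idle {V : CounterNet α} {K D : ℕ} {t : V.Call} {v : V.Ctr → ℕ} {l m : ℕ}
    {w : List α} (h : V.Resume K D t v l m w) (e : ℕ) {l' : ℕ} (hl : l' = e + l) :
    V.Resume K D t v l' m (List.replicate e V.idle ++ w) := by
  obtain ⟨v', w', rfl, hs, ha⟩ := h
  exact ⟨v', w', by rw [hl, List.replicate_add, List.append_assoc], hs, ha⟩

theorem Resume.body {V : CounterNet α} {K D : ℕ} {t : V.Call} {v v₁ : V.Ctr → ℕ} {l m : ℕ}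
    {w : List α} (h : V.Resume K D t v₁ l m w)
    (hs : Shift (V.callPre 1 t) (V.callPost 1 t) v v₁) :
    V.Resume K D t v (1 + l) (1 + m) (V.idle :: w) := by
  obtain ⟨v', w', rfl, hs', ha⟩ := h
  exact ⟨v', w', by rw [List.replicate_add]; rfl, V.shift_call_add.2 ⟨_, hs, hs'⟩, ha⟩

/-- The number of labels of a whole call with `k * k` rounds. -/
def callLen (k d : ℕ) : ℕ :=
  1 + d + outerLen k d k

/-- What a path of `V.lower` from a given configuration means for `V`. -/
def Reflects (V : CounterNet α) (k d : ℕ) :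
    V.State ⊕ LoopState → (V.Ctr ⊕ (LoopCtr ⊕ V.Call) → ℕ) → List α → Prop
  | .inl q, u, w => ∀ v, u = loopVal v 0 0 0 0 0 → V.Acc (k * k) (callLen k d) q v w
  | .inr .entry, u, w => ∀ v t, u = loopVal v 0 0 0 0 (Pi.single t 1) →
      V.Resume (k * k) (callLen k d) t v (d + outerLen k d k) (k * k) w
  | .inr .outer, u, w => ∀ v t a a', a + a' = k → u = loopVal v a a' 0 0 (Pi.single t 1) →
      V.Resume (k * k) (callLen k d) t v (outerLen k d a) (a * k) w
  | .inr .fill, u, w => ∀ v t a a', a + 1 + a' = k + 1 →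
      u = loopVal v a a' 0 0 (Pi.single t 1) →
      V.Resume (k * k) (callLen k d) t v (d + k + d + outerLen k d a) (a * k + k) w
  | .inr .inner, u, w => ∀ v t a a' j j', a + a' = k → j + j' = k →
      u = loopVal v a a' j j' (Pi.single t 1) →
      V.Resume (k * k) (callLen k d) t v (j + d + outerLen k d a) (a * k + j) w
  | .inr .exit, u, w => ∀ v t, u = loopVal v 0 0 0 0 (Pi.single t 1) →
      V.Resume (k * k) (callLen k d) t v 1 0 w

theorem outerLen_succ (k d a : ℕ) :
    outerLen k d (a + 1) = 1 + (d + k + d + outerLen k d a) := by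
  simp only [outerLen]; ring

/-- Every loop state has its own invariant in `Reflects`. Under these invariants a loop step needs a
positive counter and leaving the loop needs that counter to be zero, so neither leaving early nor an
extra round is possible. -/
theorem reflects_of_acc_lower {V : CounterNet α} {k d : ℕ} {q : V.lower.State}
    {u : V.lower.Ctr → ℕ} {w : List α} (h : V.lower.Acc k d q u w) : V.Reflects k d q u w := by
  induction h with
  | done u => exact fun v _ => Acc.done v
  | step t hs _ ih =>
    rcases t with t | t | t | t | _
    · rintro v rfl
      obtain ⟨v₁, b, b', i, i', r, rfl, hv, h₁, h₂, h₃, h₄, hr⟩ := shift_loopVal.1 hs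
      obtain rfl := shift_zero_zero.1 hr
      obtain ⟨rfl, rfl, rfl, rfl⟩ : b = 0 ∧ b' = 0 ∧ i = 0 ∧ i' = 0 := by omega
      exact Acc.step t hv (ih _ rfl)
    · rintro v rfl
      obtain ⟨v₁, b, b', i, i', r, rfl, hv, h₁, h₂, h₃, h₄, hr⟩ := shift_loopVal.1 hs
      obtain rfl := shift_zero_left.1 hr
      obtain rfl := shift_zero_zero.1 hv
      obtain ⟨rfl, rfl, rfl, rfl⟩ : b = 0 ∧ b' = 0 ∧ i = 0 ∧ i' = 0 := by omega
      obtain ⟨v', w', e, hs', ha⟩ := (ih _ t rfl).idle 1 (Nat.add_assoc 1 d _)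
      exact (congrArg _ e).mpr (Acc.call t hs' ha)
    · rintro v t' a a' j j' ha hj rfl
      obtain ⟨v₁, b, b', i, i', r, rfl, hv, h₁, h₂, h₃, h₄, hr⟩ := shift_loopVal.1 hs
      obtain ⟨ht, rfl⟩ := shift_self.1 hr
      -- The token admits only the body of the call that is being executed.
      obtain rfl := single_one_le_single_one.1 ht
      obtain rfl : j = i + 1 := by omega
      have := (ih v₁ t b b' i i' (by omega) (by omega) rfl).body hv
      obtain rfl : b = a := by omega
      rw [show i + 1 + d + outerLen k d b = 1 + (i + d + outerLen k d b) by ring,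
        show b * k + (i + 1) = 1 + (b * k + i) by ring]
      exact this
    · rintro v t' rfl
      obtain ⟨v₁, b, b', i, i', r, rfl, hv, h₁, h₂, h₃, h₄, hr⟩ := shift_loopVal.1 hs
      obtain ⟨ht, hr⟩ := shift_zero_right.1 hr
      obtain rfl := single_one_le_single_one.1 ht
      obtain rfl : r = 0 := by simpa using hr
      obtain rfl := shift_zero_zero.1 hv
      obtain ⟨rfl, rfl, rfl, rfl⟩ : b = 0 ∧ b' = 0 ∧ i = 0 ∧ i' = 0 := by omega
      exact ⟨_, _, rfl, V.shift_call_zero.2 rfl, ih _ rfl⟩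
    · rintro v t a a' ha rfl
      obtain ⟨v₁, b, b', i, i', r, rfl, hv, h₁, h₂, h₃, h₄, hr⟩ := shift_loopVal.1 hs
      obtain rfl := shift_zero_zero.1 hr
      obtain rfl := shift_zero_zero.1 hv
      obtain rfl : a = b + 1 := by omega
      obtain ⟨rfl, rfl⟩ : i = 0 ∧ i' = 0 := by omega
      rw [Nat.succ_mul]
      exact (ih _ t b b' (by omega) rfl).idle 1 (outerLen_succ k d b)
  | call t hs _ ih =>
    replace hs := (V.shift_lower_call k t).1 hs
    rcases t with _ | _ | _ | _ <;>
      simp only [reduceCtorEq, if_true, if_false] at hs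
    · rintro v t rfl
      obtain ⟨v₁, b, b', i, i', r, rfl, hv, h₁, h₂, h₃, h₄, hr⟩ := shift_loopVal.1 hs
      obtain rfl := shift_zero_zero.1 hr
      obtain rfl := shift_zero_zero.1 hv
      obtain ⟨rfl, rfl, rfl, rfl⟩ : b = k ∧ b' = 0 ∧ i = 0 ∧ i' = 0 := by omega
      exact (ih v₁ t b 0 rfl rfl).idle d rfl
    · rintro v t a a' ha rfl
      obtain ⟨v₁, b, b', i, i', r, rfl, hv, h₁, h₂, h₃, h₄, hr⟩ := shift_loopVal.1 hs
      obtain rfl := shift_zero_zero.1 hr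
      obtain rfl := shift_zero_zero.1 hv
      -- The zero test: `k ≤ a'` and `a + a' = k` force `a = 0`, and `x'` is reset for the next use.
      obtain ⟨rfl, rfl, rfl, rfl, rfl⟩ : a = 0 ∧ b = 0 ∧ b' = 0 ∧ i = 0 ∧ i' = 0 := by omega
      rw [Nat.zero_mul]
      exact (ih v₁ t rfl).idle d (by simp [outerLen])
    · rintro v t a a' ha rfl
      obtain ⟨v₁, b, b', i, i', r, rfl, hv, h₁, h₂, h₃, h₄, hr⟩ := shift_loopVal.1 hs
      obtain rfl := shift_zero_zero.1 hr
      obtain rfl := shift_zero_zero.1 hv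
      obtain ⟨rfl, rfl, rfl, rfl⟩ : b = a ∧ b' = a' ∧ i = k ∧ i' = 0 := by omega
      exact (ih v₁ t b b' i 0 (by omega) rfl rfl).idle d (by ring)
    · rintro v t a a' j j' ha hj rfl
      obtain ⟨v₁, b, b', i, i', r, rfl, hv, h₁, h₂, h₃, h₄, hr⟩ := shift_loopVal.1 hs
      obtain rfl := shift_zero_zero.1 hr
      obtain rfl := shift_zero_zero.1 hv
      -- The same zero test for the inner loop, which forces `j = 0`.
      obtain ⟨rfl, rfl, rfl, rfl, rfl⟩ : b = a ∧ b' = a' ∧ i = 0 ∧ i' = 0 ∧ j = 0 := by omega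
      exact (ih v₁ t b b' (by omega) rfl).idle d (by ring)

/-! ### Paths of the original lift to the lowered automaton. -/

theorem acc_lower_exit {V : CounterNet α} {k d : ℕ} {t : V.Call} {v : V.Ctr → ℕ} {w : List α}
    (h : V.lower.Acc k d (.inl (V.callDst t)) (loopVal v 0 0 0 0 0) w) :
    V.lower.Acc k d (.inr .exit) (loopVal v 0 0 0 0 (Pi.single t 1)) (V.idle :: w) :=
  Acc.step (V := V.lower) (.inr (.inr (.inr (.inl t))))
    (shift_loopVal.2 ⟨_, _, _, _, _, _, rfl, shift_zero_zero.2 rfl, by simp, by simp, by simp,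
      by simp, shift_zero_right.2 ⟨le_rfl, zero_add _⟩⟩) h

/-- `Acc` is built from its end, so the valuation `v'` after the loop is fixed and the one before it
varies in the induction on the remaining rounds. -/
theorem acc_lower_inner {V : CounterNet α} {k d : ℕ} {t : V.Call} {v' : V.Ctr → ℕ} {w : List α}
    {a a' : ℕ}
    (h : V.lower.Acc k d (.inr .outer) (loopVal v' a a' 0 0 (Pi.single t 1)) w) (j : ℕ) :
    ∀ (j' : ℕ) (v : V.Ctr → ℕ), j + j' = k → Shift (V.callPre j t) (V.callPost j t) v v' →
      V.lower.Acc k d (.inr .inner) (loopVal v a a' j j' (Pi.single t 1))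
        (List.replicate (j + d) V.idle ++ w) := by
  induction j with
  | zero =>
    rintro j' v rfl hs
    obtain rfl := V.shift_call_zero.1 hs
    rw [Nat.zero_add] at h ⊢
    rw [Nat.zero_add]
    exact Acc.call (V := V.lower) LoopCtr.y' ((V.shift_lower_call _ _).2
      (shift_loopVal.2 ⟨_, _, _, _, _, _, rfl, shift_zero_zero.2 rfl, by simp, by simp, by simp,
        by simp, shift_zero_zero.2 rfl⟩)) h
  | succ j ih =>
    intro j' v hj hs
    rw [Nat.add_comm j 1] at hs
    obtain ⟨u, hu, hs⟩ := V.shift_call_add.1 hs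
    rw [Nat.add_right_comm, List.replicate_succ]
    exact Acc.step (V := V.lower) (.inr (.inr (.inl t)))
      (shift_loopVal.2 ⟨_, _, _, _, _, _, rfl, hu, by simp, by simp, by simp,
        by simp, shift_self.2 ⟨le_rfl, rfl⟩⟩) (ih (j' + 1) u (by omega) hs)

theorem acc_lower_outer {V : CounterNet α} {k d : ℕ} {t : V.Call} {v' : V.Ctr → ℕ} {w : List α}
    (h : V.lower.Acc k d (.inl (V.callDst t)) (loopVal v' 0 0 0 0 0) w) (a : ℕ) :
    ∀ (a' : ℕ) (v : V.Ctr → ℕ), a + a' = k →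
      Shift (V.callPre (a * k) t) (V.callPost (a * k) t) v v' →
      V.lower.Acc k d (.inr .outer) (loopVal v a a' 0 0 (Pi.single t 1))
        (List.replicate (outerLen k d a) V.idle ++ w) := by
  induction a with
  | zero =>
    rintro a' v rfl hs
    rw [Nat.zero_mul] at hs
    obtain rfl := V.shift_call_zero.1 hs
    rw [Nat.zero_add] at h ⊢
    rw [outerLen, Nat.zero_mul, Nat.zero_add, List.replicate_add, List.append_assoc]
    exact Acc.call (V := V.lower) LoopCtr.x' ((V.shift_lower_call _ _).2
      (shift_loopVal.2 ⟨_, _, _, _, _, _, rfl, shift_zero_zero.2 rfl, by simp, by simp, by simp,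
        by simp, shift_zero_zero.2 rfl⟩)) (acc_lower_exit h)
  | succ a ih =>
    intro a' v ha hs
    rw [Nat.succ_mul, Nat.add_comm] at hs
    obtain ⟨u, hu, hs⟩ := V.shift_call_add.1 hs
    rw [outerLen_succ, show 1 + (d + k + d + outerLen k d a) =
      (d + ((k + d) + outerLen k d a)) + 1 by ring, List.replicate_succ, List.replicate_add,
      List.replicate_add (m := k + d)]
    simp only [List.cons_append, List.append_assoc]
    refine Acc.step (V := V.lower) (.inr (.inr (.inr (.inr ()))))
      (shift_loopVal.2 ⟨v, a, a' + 1, 0, 0, Pi.single t 1, rfl, shift_zero_zero.2 rfl, by simp,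
        by simp, by simp, by simp, shift_zero_zero.2 rfl⟩) ?_
    refine Acc.call (V := V.lower) LoopCtr.y ((V.shift_lower_call _ _).2
      (shift_loopVal.2 ⟨v, a, a' + 1, k, 0, Pi.single t 1, rfl, shift_zero_zero.2 rfl, by simp,
        by simp, by simp, by simp, shift_zero_zero.2 rfl⟩)) ?_
    exact acc_lower_inner (ih (a' + 1) u (by omega) hs) k 0 v (by omega) hu

theorem acc_lower_of_acc {V : CounterNet α} {k d : ℕ} {q : V.State} {v : V.Ctr → ℕ} {w : List α}
    (h : V.Acc (k * k) (callLen k d) q v w) :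
    V.lower.Acc k d (.inl q) (loopVal v 0 0 0 0 0) w := by
  induction h with
  | done v => exact Acc.done _
  | step t hs _ ih =>
    exact Acc.step (V := V.lower) (.inl t) (shift_loopVal.2 ⟨_, _, _, _, _, _, rfl, hs, by simp,
      by simp, by simp, by simp, shift_zero_zero.2 rfl⟩) ih
  | call t hs _ ih =>
    rw [callLen, Nat.add_assoc, Nat.add_comm, List.replicate_succ, List.replicate_add]
    simp only [List.cons_append, List.append_assoc]
    refine Acc.step (V := V.lower) (.inr (.inl t)) (shift_loopVal.2 ⟨_, 0, 0, 0, 0, Pi.single t 1,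
      rfl, shift_zero_zero.2 rfl, by simp, by simp, by simp, by simp, shift_zero_left.2 rfl⟩) ?_
    refine Acc.call (V := V.lower) LoopCtr.x ((V.shift_lower_call _ _).2
      (shift_loopVal.2 ⟨_, k, 0, 0, 0, Pi.single t 1, rfl, shift_zero_zero.2 rfl, by simp,
        by simp, by simp, by simp, shift_zero_zero.2 rfl⟩)) ?_
    exact acc_lower_outer ih k 0 _ (by omega) hs

theorem acc_lower_iff {V : CounterNet α} {k d : ℕ} {w : List α} :
    V.lower.Acc k d V.lower.start 0 w ↔ V.Acc (k * k) (callLen k d) V.start 0 w := by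
  have h : (0 : V.Ctr ⊕ (LoopCtr ⊕ V.Call) → ℕ) = loopVal 0 0 0 0 0 0 := by
    funext c
    rcases c with c | (_ | _ | _ | _) | t <;> rfl
  exact ⟨fun ha => reflects_of_acc_lower ha 0 h, fun ha => by
    have := acc_lower_of_acc ha
    rwa [← h] at this⟩

/-- The label length of a call of amount `2 ^ 2 ^ n` after `n` steps of lowering. -/
def callLenIter : ℕ → ℕ
  | 0 => 1
  | n + 1 => callLen (2 ^ 2 ^ n) (callLenIter n)

/-- Amounts square at each level, from `2` at the bottom to `2 ^ 2 ^ n` at the top. The induction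
peels off the top level, hence the generalization over `V`. -/
theorem acc_lower_iterate_iff (n : ℕ) {V : CounterNet α} {w : List α} :
    (lower^[n] V).Acc 2 1 (lower^[n] V).start 0 w ↔
      V.Acc (2 ^ 2 ^ n) (callLenIter n) V.start 0 w := by
  induction n generalizing V with
  | zero => rfl
  | succ n ih =>
    rw [Function.iterate_succ_apply, ih, acc_lower_iff, callLenIter, ← pow_add, pow_succ, mul_two]

end CounterNet

/-! ### Translation to Petri nets. -/

namespace CounterNet

variable {α : Type}

/-- The marking with one token on the control state `q` and the counters `v`. -/
def marking (V : CounterNet α) (q : V.State) (v : V.Ctr → ℕ) : V.State ⊕ V.Ctr → ℕ :=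
  Sum.elim (Pi.single q 1) v

/-- The tokens that a transition consumes. -/
def input (V : CounterNet α) (k : ℕ) : V.Trans ⊕ V.Call → V.State ⊕ V.Ctr → ℕ
  | .inl t => V.marking (V.src t) (V.pre t)
  | .inr t => V.marking (V.callSrc t) (V.callPre k t)

/-- The tokens that a transition produces. -/
def output (V : CounterNet α) (k : ℕ) : V.Trans ⊕ V.Call → V.State ⊕ V.Ctr → ℕ
  | .inl t => V.marking (V.dst t) (V.post t)
  | .inr t => V.marking (V.callDst t) (V.callPost k t)

/-- The Petri net of a counter automaton, with calls of amount `k` as transitions. -/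
def toPetriNet (V : CounterNet α) (k : ℕ) : PetriNet α where
  Place := V.State ⊕ V.Ctr
  Trans := V.Trans ⊕ V.Call
  flow
    | .inl p, .inr t => V.input k t p
    | .inr t, .inl p => V.output k t p
    | _, _ => 0
  label := Sum.elim V.label fun _ => V.idle
  init := V.marking V.start 0
  final := V.marking V.final 0

theorem fires_toPetriNet_iff {V : CounterNet α} {k : ℕ} {M M' : V.State ⊕ V.Ctr → ℕ}
    {t : V.Trans ⊕ V.Call} :
    (V.toPetriNet k).Fires M t M' ↔ Shift (V.input k t) (V.output k t) M M' := by
  constructor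
  · rintro ⟨h₁, h₂⟩ p
    have h₁ := h₁ p
    have h₂ := h₂ p
    change V.input k t p ≤ M p at h₁
    change M' p = M p - V.input k t p + V.output k t p at h₂
    omega
  · refine fun h => ⟨fun p => (h p).1, fun p => ?_⟩
    have := h p
    change M' p = M p - V.input k t p + V.output k t p
    omega

/-- With exactly one token on the control states, a transition is enabled only if it consumes that
token, and it puts exactly one back. -/
theorem shift_marking {V : CounterNet α} {q₁ q₂ q : V.State} {p₁ p₂ v : V.Ctr → ℕ}
    {M : V.State ⊕ V.Ctr → ℕ} :
    Shift (V.marking q₁ p₁) (V.marking q₂ p₂) (V.marking q v) M ↔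
      q₁ = q ∧ ∃ v', M = V.marking q₂ v' ∧ Shift p₁ p₂ v v' := by
  constructor
  · intro h
    have hs : Shift (Pi.single q₁ 1) (Pi.single q₂ 1) (Pi.single q 1) fun s => M (.inl s) :=
      fun s => h (.inl s)
    obtain rfl := single_one_le_single_one.1 fun s => (hs s).1
    refine ⟨rfl, fun c => M (.inr c), ?_, fun c => h (.inr c)⟩
    funext p
    rcases p with s | c
    · exact Nat.add_right_cancel ((hs s).2.trans (Nat.add_comm _ _))
    · rfl
  · rintro ⟨rfl, v', rfl, hs⟩
    rintro (s | c)
    · exact ⟨le_rfl, Nat.add_comm _ _⟩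
    · exact hs c

theorem acc_of_run {V : CounterNet α} {k : ℕ} {M M' : (V.toPetriNet k).Place → ℕ} {w : List α}
    (h : (V.toPetriNet k).Run M w M') :
    ∀ q v, M = V.marking q v → V.marking V.final 0 ≤ M' → V.Acc k 1 q v w := by
  induction h with
  | nil M =>
    rintro q v rfl hM
    obtain rfl := single_one_le_single_one.1 fun s => hM (.inl s)
    exact Acc.done v
  | cons t hf _ ih =>
    rintro q v rfl hM
    have hs := fires_toPetriNet_iff.1 hf
    rcases t with t | t
    · obtain ⟨rfl, v', rfl, hv⟩ := shift_marking.1 hs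
      exact Acc.step t hv (ih _ _ rfl hM)
    · obtain ⟨rfl, v', rfl, hv⟩ := shift_marking.1 hs
      exact Acc.call t hv (ih _ _ rfl hM)

theorem exists_run_of_acc {V : CounterNet α} {k : ℕ} {q : V.State} {v : V.Ctr → ℕ} {w : List α}
    (h : V.Acc k 1 q v w) :
    ∃ M', (V.toPetriNet k).Run (V.marking q v) w M' ∧ V.marking V.final 0 ≤ M' := by
  induction h with
  | done v =>
    refine ⟨_, PetriNet.Run.nil _, ?_⟩
    rintro (s | c)
    exacts [le_rfl, Nat.zero_le _]
  | step t hs _ ih =>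
    obtain ⟨M', hr, hM⟩ := ih
    exact ⟨M', PetriNet.Run.cons (N := V.toPetriNet k) (.inl t)
      (fires_toPetriNet_iff.2 (shift_marking.2 ⟨rfl, _, rfl, hs⟩)) hr, hM⟩
  | call t hs _ ih =>
    obtain ⟨M', hr, hM⟩ := ih
    exact ⟨M', PetriNet.Run.cons (N := V.toPetriNet k) (.inr t)
      (fires_toPetriNet_iff.2 (shift_marking.2 ⟨rfl, _, rfl, hs⟩)) hr, hM⟩

theorem mem_language_toPetriNet {V : CounterNet α} {k : ℕ} {w : List α} :
    w ∈ (V.toPetriNet k).language ↔ V.Acc k 1 V.start 0 w :=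
  ⟨fun ⟨_, hr, hM⟩ => acc_of_run hr _ _ rfl hM, exists_run_of_acc⟩

/-! ### Size bounds. -/

/-- A bound on the components of a counter automaton. -/
structure SizeLE (V : CounterNet α) (s c t l : ℕ) : Prop where
  state : Fintype.card V.State ≤ s
  ctr : Fintype.card V.Ctr ≤ c
  trans : Fintype.card V.Trans ≤ t
  call : Fintype.card V.Call ≤ l
  pre_le : ∀ t c, V.pre t c ≤ 1
  post_le : ∀ t c, V.post t c ≤ 1

theorem single_le {C : Type} [DecidableEq C] (c c' : C) (k : ℕ) :
    (Pi.single c k : C → ℕ) c' ≤ k := by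
  rw [Pi.single_apply]
  split_ifs <;> simp

theorem callPre_le (V : CounterNet α) (k : ℕ) (t : V.Call) (c : V.Ctr) : V.callPre k t c ≤ k := by
  unfold callPre
  split_ifs
  exacts [Nat.zero_le _, single_le _ _ _]

theorem callPost_le (V : CounterNet α) (k : ℕ) (t : V.Call) (c : V.Ctr) :
    V.callPost k t c ≤ k := by
  unfold callPost
  split_ifs
  exacts [single_le _ _ _, Nat.zero_le _]

theorem loopVal_le_one {C T : Type} {v : C → ℕ} {a a' j j' : ℕ} {r : T → ℕ} (hv : ∀ c, v c ≤ 1)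
    (ha : a ≤ 1) (ha' : a' ≤ 1) (hj : j ≤ 1) (hj' : j' ≤ 1) (hr : ∀ t, r t ≤ 1) (c) :
    loopVal v a a' j j' r c ≤ 1 := by
  rcases c with c | (_ | _ | _ | _) | t
  exacts [hv c, ha, ha', hj, hj', hr t]

/-- The lowered automaton has exactly four calls whatever `V` has, so the increments do not depend
on the level and growth is linear rather than exponential. -/
theorem SizeLE.lower {V : CounterNet α} {s c t : ℕ} (h : V.SizeLE s c t 4) :
    V.lower.SizeLE (s + 5) (c + 8) (t + 13) 4 where
  state := by
    have : Fintype.card V.lower.State = Fintype.card V.State + 5 := Fintype.card_sum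
    have := h.state
    omega
  ctr := by
    have : Fintype.card V.lower.Ctr = Fintype.card V.Ctr + (4 + Fintype.card V.Call) :=
      Fintype.card_sum.trans (congrArg _ Fintype.card_sum)
    have := h.ctr
    have := h.call
    omega
  trans := by
    have : Fintype.card V.lower.Trans = Fintype.card V.Trans + (Fintype.card V.Call +
        (Fintype.card V.Call + (Fintype.card V.Call + 1))) := by
      change Fintype.card (V.Trans ⊕ (V.Call ⊕ (V.Call ⊕ (V.Call ⊕ Unit)))) = _
      simp only [Fintype.card_sum, Fintype.card_unit]
    have := h.trans
    have := h.call
    omega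
  call := le_of_eq rfl
  pre_le := by
    rintro (t | t | t | t | _) <;> refine loopVal_le_one ?_ ?_ ?_ ?_ ?_ ?_ <;>
      first
        | exact h.pre_le t
        | exact V.callPre_le 1 t
        | exact fun c => single_le _ _ _
        | simp
  post_le := by
    rintro (t | t | t | t | _) <;> refine loopVal_le_one ?_ ?_ ?_ ?_ ?_ ?_ <;>
      first
        | exact h.post_le t
        | exact V.callPost_le 1 t
        | exact fun c => single_le _ _ _
        | simp

theorem SizeLE.lower_iterate {V : CounterNet α} {s c t : ℕ} (h : V.SizeLE s c t 4) (n : ℕ) :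
    (CounterNet.lower^[n] V).SizeLE (s + 5 * n) (c + 8 * n) (t + 13 * n) 4 := by
  induction n with
  | zero => exact h
  | succ n ih =>
    rw [Function.iterate_succ_apply']
    exact ih.lower

theorem marking_le {V : CounterNet α} {k : ℕ} (hk : 1 ≤ k) (q : V.State) {v : V.Ctr → ℕ}
    (hv : ∀ c, v c ≤ k) (p) : V.marking q v p ≤ k := by
  rcases p with s | c
  exacts [(single_le _ _ _).trans hk, hv c]

theorem SizeLE.size_toPetriNet {V : CounterNet α} {s c t l : ℕ} (h : V.SizeLE s c t l) :
    (V.toPetriNet 2).size ≤ (s + c) * (t + l) * 3 + 4 * (s + c) := by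
  have hP : Fintype.card (V.toPetriNet 2).Place ≤ s + c :=
    Fintype.card_sum.trans_le (Nat.add_le_add h.state h.ctr)
  have hT : Fintype.card (V.toPetriNet 2).Trans ≤ t + l :=
    Fintype.card_sum.trans_le (Nat.add_le_add h.trans h.call)
  have hF : (V.toPetriNet 2).flowNorm ≤ 2 := by
    refine Finset.sup_le ?_
    rintro ⟨p | t, p' | t'⟩ -
    · exact Nat.zero_le _
    · change V.input 2 t' p ≤ 2
      rcases t' with t | t
      · exact marking_le one_le_two _ (fun c => (h.pre_le t c).trans one_le_two) _
      · exact marking_le one_le_two _ (V.callPre_le 2 t) _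
    · change V.output 2 t p' ≤ 2
      rcases t with t | t
      · exact marking_le one_le_two _ (fun c => (h.post_le t c).trans one_le_two) _
      · exact marking_le one_le_two _ (V.callPost_le 2 t) _
    · exact Nat.zero_le _
  have hM : ∀ q, (V.toPetriNet 2).markingSize (V.marking q 0) ≤ (s + c) * 2 := fun q => by
    refine Nat.mul_le_mul hP ?_
    have : (V.toPetriNet 2).markingNorm (V.marking q 0) ≤ 1 :=
      Finset.sup_le fun p _ => marking_le le_rfl q (fun _ => Nat.zero_le _) p
    have := Nat.clog_mono_right 2 (Nat.add_le_add_left this 1)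
    rw [show Nat.clog 2 (1 + 1) = 1 by decide +kernel] at this
    omega
  have hlog : 1 + Nat.clog 2 (1 + (V.toPetriNet 2).flowNorm) ≤ 3 := by
    have := Nat.clog_mono_right 2 (Nat.add_le_add_left hF 1)
    rw [show Nat.clog 2 (1 + 2) = 2 by decide +kernel] at this
    omega
  have h₁ := Nat.mul_le_mul (Nat.mul_le_mul hP hT) hlog
  have h₂ := hM V.start
  have h₃ := hM V.final
  change _ + (V.toPetriNet 2).markingSize (V.marking V.start 0) +
    (V.toPetriNet 2).markingSize (V.marking V.final 0) ≤ _
  omega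

end CounterNet

/-! ### The automaton for the `k`-th last letter. -/

/-- The control states of `bitNet`. -/
inductive BitState
  | unloaded | loaded | reading | counting | counted | checked
  deriving DecidableEq

instance : Fintype BitState :=
  ⟨{.unloaded, .loaded, .reading, .counting, .counted, .checked}, fun s => by cases s <;> decide⟩

/-- The ordinary transitions of `bitNet`. -/
inductive BitTrans
  | begin
  | read (y : Bool)
  | guess
  | count (y : Bool)
  | finish
  deriving DecidableEq

instance : Fintype BitTrans :=
  ⟨{.begin, .read false, .read true, .guess, .count false, .count true, .finish}, fun t => by
    rcases t with _ | (_ | _) | _ | (_ | _) | _ <;> decide⟩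

/-- The automaton that guesses the position of the letter `x` and counts the letters from there on,
by moving one unit per letter from the counter `false`, loaded by a first call, to the counter
`true`, checked by a second call. -/
def bitNet (x : Bool) : CounterNet Letter where
  State := BitState
  Ctr := Bool
  Trans := BitTrans
  Call := Bool
  src
    | .begin => .loaded
    | .read _ => .reading
    | .guess => .reading
    | .count _ => .counting
    | .finish => .counting
  dst
    | .begin => .reading
    | .read _ => .reading
    | .guess => .counting
    | .count _ => .counting
    | .finish => .counted
  label
    | .begin => .c
    | .read y => .bit y
    | .guess => .bit x
    | .count y => .bit y
    | .finish => .c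
  pre
    | .guess | .count _ => Pi.single false 1
    | _ => 0
  post
    | .guess | .count _ => Pi.single true 1
    | _ => 0
  callSrc i := if i then .counted else .unloaded
  callDst i := if i then .checked else .loaded
  callUp i := !i
  callCtr i := i
  idle := .b
  start := .unloaded
  final := .checked

theorem bitNet_sizeLE (x : Bool) : (bitNet x).SizeLE 6 2 7 4 where
  state := le_of_eq rfl
  ctr := le_of_eq rfl
  trans := le_of_eq rfl
  call := show 2 ≤ 4 by norm_num
  pre_le t c := by
    cases t <;> first | exact Nat.zero_le _ | exact CounterNet.single_le _ _ _
  post_le t c := by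
    cases t <;> first | exact Nat.zero_le _ | exact CounterNet.single_le _ _ _

theorem shift_bitNet_call {x : Bool} {k : ℕ} (i : Bool) {v w : Bool → ℕ} :
    Shift ((bitNet x).callPre k i) ((bitNet x).callPost k i) v w ↔
      (if i then k else 0) ≤ v true ∧ w false = v false + (if i then 0 else k) ∧
        w true + (if i then k else 0) = v true := by
  constructor
  · intro h
    have hf := h false
    have ht := h true
    cases i
    · exact ⟨ht.1, hf.2, ht.2⟩
    · exact ⟨ht.1, hf.2, ht.2⟩
  · intro h
    cases i
    · rintro (_ | _)
      exacts [⟨Nat.zero_le _, h.2.1⟩, ⟨h.1, h.2.2⟩]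
    · rintro (_ | _)
      exacts [⟨Nat.zero_le _, h.2.1⟩, ⟨h.1, h.2.2⟩]

theorem cons_mem_kthLastLang {x y : Bool} {k : ℕ} {u : List Bool} (h : u ∈ kthLastLang x k) :
    y :: u ∈ kthLastLang x k := by
  obtain ⟨s, t, rfl, ht⟩ := h
  exact ⟨y :: s, t, rfl, ht⟩

/-- The end of the words accepted by `bitNet`. -/
def suffixWord (d : ℕ) (u : List Bool) : List Letter :=
  u.map Letter.bit ++ Letter.c :: List.replicate d Letter.b

/-- The words that lead from a configuration of `bitNet` to its final state. -/
def BitSpec (x : Bool) (k d : ℕ) : BitState → (Bool → ℕ) → List Letter → Prop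
  | .unloaded, v, w => v = 0 → ∃ u ∈ kthLastLang x k,
      w = List.replicate d Letter.b ++ Letter.c :: suffixWord d u
  | .loaded, v, w => v false = k → v true = 0 → ∃ u ∈ kthLastLang x k,
      w = Letter.c :: suffixWord d u
  | .reading, v, w => v false = k → v true = 0 → ∃ u ∈ kthLastLang x k, w = suffixWord d u
  | .counting, v, w => v false + v true = k → ∃ u : List Bool, u.length = v false ∧
      w = suffixWord d u
  | .counted, v, w => v false + v true = k → v false = 0 ∧ w = List.replicate d Letter.b
  | .checked, _, w => w = []

theorem bitSpec_of_acc {x : Bool} {k d : ℕ} {q : (bitNet x).State} {v : (bitNet x).Ctr → ℕ}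
    {w : List Letter} (h : (bitNet x).Acc k d q v w) : BitSpec x k d q v w := by
  induction h with
  | done v => rfl
  | step t hs _ ih =>
    have hf := hs false
    have ht := hs true
    rcases t with _ | y | _ | y | _ <;>
      simp only [bitNet, Pi.zero_apply, Pi.single_eq_same, Pi.single_apply, reduceCtorEq,
        if_false] at hf ht
    · intro h₁ h₂
      obtain ⟨u, hu, rfl⟩ := ih (by omega) (by omega)
      exact ⟨u, hu, rfl⟩
    · intro h₁ h₂
      obtain ⟨u, hu, rfl⟩ := ih (by omega) (by omega)
      exact ⟨y :: u, cons_mem_kthLastLang hu, rfl⟩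
    · intro h₁ h₂
      obtain ⟨u, hu, rfl⟩ := ih (by omega)
      -- The guessed letter itself uses one unit, so `k - 1` units remain for `u`.
      exact ⟨x :: u, ⟨[], u, rfl, by omega⟩, rfl⟩
    · intro h₁
      obtain ⟨u, hu, rfl⟩ := ih (by omega)
      exact ⟨y :: u, by rw [List.length_cons]; omega, rfl⟩
    · intro h₁
      obtain ⟨h₂, rfl⟩ := ih (by omega)
      exact ⟨[], by rw [List.length_nil]; omega, rfl⟩
  | call t hs _ ih =>
    obtain ⟨h₀, hf, ht⟩ := (shift_bitNet_call t).1 hs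
    rcases t with _ | _ <;> simp only [reduceIte, Bool.false_eq_true] at h₀ hf ht
    · rintro rfl
      obtain ⟨u, hu, rfl⟩ := ih (hf.trans (Nat.zero_add k)) ht
      exact ⟨u, hu, rfl⟩
    · intro h₁
      obtain rfl := ih
      -- The final call needs `k` units on `true`; as the sum is `k`, none is left on `false`.
      exact ⟨by omega, List.append_nil _⟩

theorem acc_bitNet_counting {x : Bool} {k d : ℕ} (u : List Bool) :
    ∀ v : Bool → ℕ, u.length = v false → v false + v true = k →
      (bitNet x).Acc k d .counting v (suffixWord d u) := by
  induction u with
  | nil =>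
    intro v hu hk
    rw [List.length_nil] at hu
    refine CounterNet.Acc.step (V := bitNet x) .finish (shift_zero_zero.2 rfl) ?_
    rw [← List.append_nil (List.replicate d Letter.b)]
    refine CounterNet.Acc.call (V := bitNet x) true (v' := fun _ => 0)
      ((shift_bitNet_call true).2 ?_) (CounterNet.Acc.done _)
    simp only [if_true]
    omega
  | cons y u ih =>
    intro v hu hk
    rw [List.length_cons] at hu
    refine CounterNet.Acc.step (V := bitNet x) (.count y)
      (v' := fun i : Bool => if i then v true + 1 else v false - 1) ?_ (ih _ ?_ ?_)
    · rintro (_ | _) <;> simp [bitNet] ; omega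
    · simp; omega
    · simp; omega

theorem acc_bitNet_reading {x : Bool} {k d : ℕ} {v : Bool → ℕ} (hf : v false = k)
    (ht : v true = 0) {s t : List Bool} (hl : t.length + 1 = k) :
    (bitNet x).Acc k d .reading v (suffixWord d (s ++ x :: t)) := by
  induction s with
  | nil =>
    refine CounterNet.Acc.step (V := bitNet x) .guess
      (v' := fun i : Bool => if i then v true + 1 else v false - 1) ?_ (acc_bitNet_counting t _ ?_ ?_)
    · rintro (_ | _) <;> simp [bitNet] ; omega
    · simp; omega
    · simp; omega
  | cons y s ih =>
    exact CounterNet.Acc.step (V := bitNet x) (.read y) (shift_zero_zero.2 rfl) ih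

theorem acc_bitNet_iff {x : Bool} {k d : ℕ} {w : List Letter} :
    (bitNet x).Acc k d (bitNet x).start 0 w ↔ ∃ u ∈ kthLastLang x k,
      w = List.replicate d Letter.b ++ Letter.c :: suffixWord d u := by
  constructor
  · exact fun h => bitSpec_of_acc h rfl
  · rintro ⟨_, ⟨s, t, rfl, hl⟩, rfl⟩
    refine CounterNet.Acc.call (V := bitNet x) false (v' := Pi.single false k) ?_ ?_
    · exact shift_zero_left.2 rfl
    · exact CounterNet.Acc.step (V := bitNet x) .begin (shift_zero_zero.2 rfl)
        (acc_bitNet_reading (v := Pi.single false k) rfl rfl hl)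

/-! ### The two nets, their languages and disjointness. -/

/-- The Petri net for the words whose `2 ^ 2 ^ n`-th last letter is `x`. -/
def bitPetriNet (x : Bool) (n : ℕ) : PetriNet Letter :=
  (CounterNet.lower^[n] (bitNet x)).toPetriNet 2

theorem mem_language_bitPetriNet {x : Bool} {n : ℕ} {w : List Letter} :
    w ∈ (bitPetriNet x n).language ↔ ∃ u ∈ kthLastLang x (2 ^ 2 ^ n),
      w = List.replicate (CounterNet.callLenIter n) Letter.b ++
        Letter.c :: suffixWord (CounterNet.callLenIter n) u := by
  rw [bitPetriNet, CounterNet.mem_language_toPetriNet, CounterNet.acc_lower_iterate_iff,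
    acc_bitNet_iff]

theorem language_bitPetriNet (x : Bool) (n : ℕ) :
    (bitPetriNet x n).language =
      {List.replicate (CounterNet.callLenIter n) Letter.b} * {[Letter.c]} *
        Language.map Letter.bit (kthLastLang x (2 ^ 2 ^ n)) * {[Letter.c]} *
        {List.replicate (CounterNet.callLenIter n) Letter.b} := by
  refine Language.ext fun w => mem_language_bitPetriNet.trans ?_
  constructor
  · rintro ⟨u, hu, rfl⟩
    have hm : u.map Letter.bit ∈ Language.map Letter.bit (kthLastLang x (2 ^ 2 ^ n)) :=
      ⟨u, hu, rfl⟩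
    exact ⟨_, ⟨_, ⟨_, ⟨_, rfl, _, rfl, rfl⟩, _, hm, rfl⟩, _, rfl, rfl⟩, _, rfl, by
      simp [suffixWord]⟩
  · intro h
    obtain ⟨_, h₁, _, rfl, rfl⟩ := Language.mem_mul.1 h
    obtain ⟨_, h₂, _, rfl, rfl⟩ := Language.mem_mul.1 h₁
    obtain ⟨_, h₃, _, ⟨u, hu, rfl⟩, rfl⟩ := Language.mem_mul.1 h₂
    obtain ⟨_, rfl, _, rfl, rfl⟩ := Language.mem_mul.1 h₃
    exact ⟨u, hu, by simp [suffixWord]⟩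

theorem size_bitPetriNet_le (x : Bool) (n : ℕ) :
    (bitPetriNet x n).size ≤
      (8 + 13 * n) * (11 + 13 * n) * 3 + 4 * (8 + 13 * n) := by
  have h := ((bitNet_sizeLE x).lower_iterate n).size_toPetriNet
  rwa [show 6 + 5 * n + (2 + 8 * n) = 8 + 13 * n by ring,
    show 7 + 13 * n + 4 = 11 + 13 * n by ring] at h

theorem bit_injective : Function.Injective Letter.bit := fun _ _ h => by
  injection h

theorem kthLastLang_unique {x y : Bool} {k : ℕ} {u : List Bool} (hx : u ∈ kthLastLang x k)
    (hy : u ∈ kthLastLang y k) : x = y := by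
  obtain ⟨s, t, rfl, ht⟩ := hx
  obtain ⟨s', t', he, ht'⟩ := hy
  have := (List.append_inj' he (by simp only [List.length_cons]; omega)).2
  injection this

theorem disjoint_bitPetriNet {x y : Bool} {n : ℕ} {w : List Letter}
    (hx : w ∈ (bitPetriNet x n).language) (hy : w ∈ (bitPetriNet y n).language) : x = y := by
  obtain ⟨u, hu, rfl⟩ := mem_language_bitPetriNet.1 hx
  obtain ⟨u', hu', he⟩ := mem_language_bitPetriNet.1 hy
  have he : suffixWord (CounterNet.callLenIter n) u = suffixWord (CounterNet.callLenIter n) u' := by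
    -- Both words have the same padding length, so the prefixes cancel.
    simpa using he
  have he := bit_injective.list_map (List.append_cancel_right he)
  subst he
  exact kthLastLang_unique hu hu'

/-! ### The lower bound for separating automata. -/

/-- Position `i` of a word of length `k`, counted from `0`, has `k - 1 - i` letters after it; `i`
more make it the `k`-th last. -/
theorem ofFn_append_mem_kthLastLang {k : ℕ} (g : Fin k → Bool) (i : Fin k) (z : List Bool)
    (hz : z.length = i) : List.ofFn g ++ z ∈ kthLastLang (g i) k := by
  refine ⟨(List.ofFn g).take i, (List.ofFn g).drop (i + 1) ++ z, ?_, ?_⟩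
  · have h : (i : ℕ) < (List.ofFn g).length := by simp
    conv_lhs => rw [← List.take_append_drop i (List.ofFn g), List.drop_eq_getElem_cons h]
    simp
  · have := i.2
    simp [hz]
    omega

theorem IsSeparator.not_iff {α : Type} {R : Language α} {L : Bool → Language α}
    (h : IsSeparator R (L false) (L true)) {x y : Bool} (hxy : x ≠ y) {w w' : List α}
    (hw : w ∈ L x) (hw' : w' ∈ L y) : ¬(w ∈ R ↔ w' ∈ R) := by
  intro hi
  cases x <;> cases y <;> first | exact hxy rfl | skip
  · rcases h with ⟨h₁, h₂⟩ | ⟨h₁, h₂⟩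
    · exact h₂ _ (hi.1 (h₁ hw)) hw'
    · exact h₂ _ (hi.2 (h₁ hw')) hw
  · rcases h with ⟨h₁, h₂⟩ | ⟨h₁, h₂⟩
    · exact h₂ _ (hi.2 (h₁ hw')) hw
    · exact h₂ _ (hi.1 (h₁ hw)) hw'

theorem two_pow_le_card_of_isSeparator {n : ℕ} {σ : Type} [Fintype σ] (A : DFA Letter σ)
    (h : IsSeparator A.accepts (bitPetriNet false n).language (bitPetriNet true n).language) :
    2 ^ 2 ^ 2 ^ n ≤ Fintype.card σ := by
  set d := CounterNet.callLenIter n with hd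
  let f : (Fin (2 ^ 2 ^ n) → Bool) → σ := fun g =>
    A.eval (List.replicate d Letter.b ++ Letter.c :: (List.ofFn g).map Letter.bit)
  have hf : Function.Injective f := by
    intro g g' hg
    by_contra hne
    obtain ⟨i, hi⟩ := Function.ne_iff.1 hne
    -- Only the length of the padding matters, not its letters.
    set z := List.replicate (i : ℕ) false
    have hz : z.length = i := List.length_replicate
    have hmem : ∀ g : Fin (2 ^ 2 ^ n) → Bool,
        (List.replicate d Letter.b ++ Letter.c :: (List.ofFn g).map Letter.bit) ++
          suffixWord d z ∈ (bitPetriNet (g i) n).language := fun g =>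
      mem_language_bitPetriNet.2 ⟨_, ofFn_append_mem_kthLastLang g i z hz, by
        simp [suffixWord, ← hd]⟩
    refine IsSeparator.not_iff (L := fun x => (bitPetriNet x n).language) h hi (hmem g) (hmem g') ?_
    have he : ∀ g, A.eval ((List.replicate d Letter.b ++ Letter.c :: (List.ofFn g).map Letter.bit) ++
        suffixWord d z) = A.evalFrom (f g) (suffixWord d z) := fun g =>
      A.evalFrom_of_append _ _ _
    rw [DFA.mem_accepts, DFA.mem_accepts, he, he, hg]
  simpa using Fintype.card_le_of_injective f hf

theorem mainTheorem8 :
    ∃ q : Polynomial ℕ, ∀ n : ℕ, ∃ N₀ N₁ : PetriNet Letter,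
      N₀.size ≤ q.eval n ∧ N₁.size ≤ q.eval n ∧
      (∃ L' L'' : Language Letter,
        (∃ w, w ∈ L') ∧ (∃ w, w ∈ L'') ∧
        (∀ w ∈ L', ∀ a ∈ w, a = Letter.b) ∧ (∀ w ∈ L'', ∀ a ∈ w, a = Letter.b) ∧
        N₀.language =
          L' * {[Letter.c]} * Language.map Letter.bit (kthLastLang false (2 ^ 2 ^ n))
            * {[Letter.c]} * L'' ∧
        N₁.language =
          L' * {[Letter.c]} * Language.map Letter.bit (kthLastLang true (2 ^ 2 ^ n))
            * {[Letter.c]} * L'') ∧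
      (∀ w ∈ N₀.language, w ∉ N₁.language) ∧
      ∀ (σ : Type) [Fintype σ] (A : DFA Letter σ),
        IsSeparator A.accepts N₀.language N₁.language → 2 ^ 2 ^ 2 ^ n ≤ Fintype.card σ := by
  
  refine ⟨(8 + 13 * Polynomial.X) * (11 + 13 * Polynomial.X) * 3 + 4 * (8 + 13 * Polynomial.X),
    fun n => ⟨bitPetriNet false n, bitPetriNet true n, ?_, ?_, ?_, ?_, ?_⟩⟩
  · simpa using size_bitPetriNet_le false n
  · simpa using size_bitPetriNet_le true n
  · exact ⟨{List.replicate (CounterNet.callLenIter n) Letter.b},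
      {List.replicate (CounterNet.callLenIter n) Letter.b}, ⟨_, rfl⟩, ⟨_, rfl⟩,
      fun w hw a ha => List.eq_of_mem_replicate (hw ▸ ha),
      fun w hw a ha => List.eq_of_mem_replicate (hw ▸ ha),
      language_bitPetriNet false n, language_bitPetriNet true n⟩
  · exact fun w h₀ h₁ => Bool.false_ne_true (disjoint_bitPetriNet h₀ h₁)
  · intro σ _ A h
    exact two_pow_le_card_of_isSeparator A h
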